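/- For $x=(x_1,x_2)$ and $y=(y_1,y_2)$ in $\mathbb N^2$ (where $0\in\mathbb N$), say that $x$ properly divides $y$ if for each $j\in\{1,2\}$ either $x_j=y_j=0$ or $x_j<y_j$. Write $x\le y$ if $x=y$ or $x$ properly divides $y$. For $a,b\in\mathbb N$ let $P(a,b)=\{x\in\mathbb N^2 : x\le (a,b)\}$, partially ordered by this relation; it has least element $\widehat 0=(0,0)$ and greatest element $\widehat 1=(a,b)$. Let $\Delta(P(a,b))$ be its order complex, that is, the simplicial complex of all chains of $P(a,b)\setminus\{\widehat 0,\widehat 1\}$, and let $H_i(\Delta(P(a,b));\mathbb Z)$ denote its $i$-th (non-reduced) simplicial homology group with integer coefficients. Proposition. For all integers $a,b$ with $2\le a\le b$ there exists an integer $t_{(a,b)}\ge 0$ such that $H_i(\Delta(P(a,b));\mathbb Z)\neq 0$ if and only if $0\le i\le t_{(a,b)}$. -/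

import Mathlib

/-! ### Simplicial homology of ordered simplicial complexes -/

/-- An abstract simplicial complex on a partially ordered vertex set in which every face is a
chain. The order orients all simplices at once: every face with `n + 1` vertices has a unique
increasing enumeration `x₀ < ⋯ < xₙ`. -/
structure OrderedSimplicialComplex (V : Type*) [PartialOrder V] extends
    AbstractSimplicialComplex V where
  isChain_of_mem : ∀ s ∈ faces, IsChain (· ≤ ·) (s : Set V)

namespace OrderedSimplicialComplex

/-- The `n`-simplices of `K`: the increasing enumerations `x₀ < ⋯ < xₙ` of the faces of `K` that
have exactly `n + 1` vertices. -/
def Simplex {V : Type*} [PartialOrder V] (K : OrderedSimplicialComplex V) (n : ℕ) : Type _ :=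
  {x : Fin (n + 1) ↪o V // Finset.univ.map x.toEmbedding ∈ K.faces}

/-- The `i`-th face `x₀ < ⋯ < x̂ᵢ < ⋯ < xₙ₊₁` of an `(n + 1)`-simplex: the vertex `xᵢ` is
omitted. -/
def Simplex.face {V : Type*} [PartialOrder V] {K : OrderedSimplicialComplex V} {n : ℕ}
    (x : K.Simplex (n + 1)) (i : Fin (n + 2)) : K.Simplex n :=
  ⟨(Fin.succAboveOrderEmb i).trans x.1, (K.isRelLowerSet_faces x.2).2
    (by intro v hv
        simp only [Finset.mem_map, Finset.mem_univ, true_and] at hv ⊢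
        obtain ⟨j, rfl⟩ := hv
        exact ⟨i.succAbove j, rfl⟩)
    (by simp)⟩

/-- The group `Cₙ(K; ℤ)` of simplicial `n`-chains: the free abelian group on the `n`-simplices. -/
abbrev Chains {V : Type*} [PartialOrder V] (K : OrderedSimplicialComplex V) (n : ℕ) : Type _ :=
  K.Simplex n →₀ ℤ

/-- The boundary map `∂ : Cₙ₊₁(K; ℤ) → Cₙ(K; ℤ)`, given on simplices by
`∂[x₀, …, xₙ₊₁] = ∑ᵢ (-1)ⁱ [x₀, …, x̂ᵢ, …, xₙ₊₁]`. -/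
noncomputable def boundary {V : Type*} [PartialOrder V] (K : OrderedSimplicialComplex V) (n : ℕ) :
    K.Chains (n + 1) →ₗ[ℤ] K.Chains n :=
  Finsupp.linearCombination ℤ fun x : K.Simplex (n + 1) =>
    ∑ i : Fin (n + 2), Finsupp.single (x.face i) ((-1 : ℤ) ^ (i : ℕ))

/-- Boundaries are cycles: `∂ ∘ ∂ = 0`. -/
theorem boundary_comp_boundary {V : Type*} [PartialOrder V] (K : OrderedSimplicialComplex V) (n : ℕ) :
    K.boundary n ∘ₗ K.boundary (n + 1) = 0 := by
  refine Finsupp.lhom_ext' fun x => LinearMap.ext_ring ?_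
  simp only [boundary, LinearMap.coe_comp, Function.comp_apply, Finsupp.lsingle_apply,
    Finsupp.linearCombination_single, one_smul, map_sum, LinearMap.zero_comp,
    LinearMap.zero_apply, Finset.smul_sum, Finsupp.smul_single, smul_eq_mul]
  rw [← Finset.sum_product']
  refine Finset.sum_involution
    (fun p _ => (p.1.succAbove p.2, p.2.predAbove p.1)) ?_ ?_ ?_ ?_
  · rintro ⟨i, j⟩ -
    have hf : (x.face (i.succAbove j)).face (j.predAbove i) = (x.face i).face j := by
      refine Subtype.ext (RelEmbedding.ext fun k => ?_)
      exact congrArg x.1 (Fin.succAbove_succAbove_succAbove_predAbove i j k)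
    simp only [hf]
    rw [← Finsupp.single_add, ← pow_add, ← pow_add,
      Fin.neg_one_pow_succAbove_add_predAbove]
    simp [pow_add]
  · rintro ⟨i, j⟩ - - h
    exact Fin.succAbove_ne i j (congrArg Prod.fst h)
  · intros; simp
  · rintro ⟨i, j⟩ -
    simp [Fin.succAbove_succAbove_predAbove, Fin.predAbove_predAbove_succAbove]

/-- The submodule of `n`-cycles; every `0`-chain is a cycle (the complex is not augmented). -/
noncomputable def cycles {V : Type*} [PartialOrder V] (K : OrderedSimplicialComplex V) :
    (n : ℕ) → Submodule ℤ (K.Chains n)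
  | 0 => ⊤
  | n + 1 => LinearMap.ker (K.boundary n)

/-- The `n`-th (non-reduced) simplicial homology `Hₙ(K; ℤ)`: cycles modulo boundaries. -/
abbrev Homology {V : Type*} [PartialOrder V] (K : OrderedSimplicialComplex V) (n : ℕ) : Type _ :=
  K.cycles n ⧸ (LinearMap.range (K.boundary n)).submoduleOf (K.cycles n)

end OrderedSimplicialComplex

/-! ### Order complexes -/

/-- The complex of all nonempty finite chains of a poset. -/
def complexOfChains (Q : Type*) [PartialOrder Q] : OrderedSimplicialComplex Q where
  faces := {s | s.Nonempty ∧ IsChain (· ≤ ·) (s : Set Q)}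
  isRelLowerSet_faces := fun _ hs =>
    ⟨hs.1, fun _ hts ht => ⟨ht, hs.2.mono (Finset.coe_subset.mpr hts)⟩⟩
  singleton_mem := fun v => ⟨Finset.singleton_nonempty v, by simp⟩
  isChain_of_mem := fun _ hs => hs.2

/-- The order complex `Δ(P)` of a poset `P` with least element `0̂` and greatest element `1̂`: the
complex of all chains of `P ∖ {0̂, 1̂}`. -/
def orderComplex (P : Type*) [PartialOrder P] [BoundedOrder P] :
    OrderedSimplicialComplex {p : P // p ≠ ⊥ ∧ p ≠ ⊤} :=
  complexOfChains {p : P // p ≠ ⊥ ∧ p ≠ ⊤}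

/-! ### The posets of proper divisibility -/

/-- `x` properly divides `y`: in each coordinate, either both entries are `0` or the entry of `x`
is strictly smaller. -/
def ProperlyDivides (x y : ℕ × ℕ) : Prop :=
  ((x.1 = 0 ∧ y.1 = 0) ∨ x.1 < y.1) ∧ ((x.2 = 0 ∧ y.2 = 0) ∨ x.2 < y.2)

/-- The poset `P(a, b)` of all `x` in `ℕ²` that are equal to `(a, b)` or properly divide it. -/
def ProperDivisorPoset (a b : ℕ) : Type :=
  {x : ℕ × ℕ // x = (a, b) ∨ ProperlyDivides x (a, b)}

/-- `P(a, b)` is ordered by proper divisibility (and not by the product order of `ℕ²`). -/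
instance ProperDivisorPoset.instPartialOrder (a b : ℕ) :
    PartialOrder (ProperDivisorPoset a b) where
  le x y := x.1 = y.1 ∨ ProperlyDivides x.1 y.1
  le_refl _ := Or.inl rfl
  le_trans x y z hxy hyz := by
    rcases hxy with h | h
    · rw [h]; exact hyz
    · rcases hyz with h' | h'
      · rw [← h']; exact Or.inr h
      · refine Or.inr ?_
        unfold ProperlyDivides at *
        omega
  le_antisymm x y hxy hyx := by
    refine Subtype.ext ?_
    rcases hxy with h | h
    · exact h
    · rcases hyx with h' | h'
      · exact h'.symm
      · unfold ProperlyDivides at *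
        exact Prod.ext (by omega) (by omega)

/-- The least element of `P(a, b)` is `(0, 0)`, the greatest one is `(a, b)`. -/
instance ProperDivisorPoset.instBoundedOrder (a b : ℕ) :
    BoundedOrder (ProperDivisorPoset a b) where
  bot := ⟨(0, 0), Or.inr (by unfold ProperlyDivides; omega)⟩
  bot_le x := Or.inr ⟨by rcases Nat.eq_zero_or_pos x.1.1 with h | h <;> simp [h],
    by rcases Nat.eq_zero_or_pos x.1.2 with h | h <;> simp [h]⟩
  top := ⟨(a, b), Or.inl rfl⟩
  le_top x := x.2

/-! Write p = (a, b) and consider the open interval below p. When both coordinates are at least 2,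
its maximal elements are t = (a-1, b-1) and the `corners`, which have a-1 or b-1 in one coordinate
and something smaller in the other. Once the corners are removed, everything else lies below t, so a
cone remains. Hence reduced homology below p in each degree is the sum, over corners x, of reduced
homology below x one degree lower (`exact_succ_iff`, `nonExact_succ_iff`). If a coordinate is at
most 1, the interval is empty or a cone.

Nonvanishing in degree d - 1 thus means that d successive corner steps lead to an empty interval.
Each step lowers the first coordinate, which bounds the degree (`le_of_nonExact`). Nonvanishing
passes from degree 2 to degree 1 by an explicit path (`nonExact_two`), and in higher degrees by
induction along a corner (`nonExact_of_succ`). Reduced homology in degree 0 may vanish while degree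
1 survives, so degree 0 is handled separately, by unreduced homology. -/

/-! ### Chains as lists

For a relation `r` on `W` (read `r x y` as `y < x`), chains of a subset of `W` are written as
decreasing lists. The empty list is included, which gives the augmented chain complex. -/

namespace ListChain

variable {W : Type*}

/-- Put `x` in front of every list. -/
noncomputable def cons (x : W) : (List W →₀ ℤ) →ₗ[ℤ] (List W →₀ ℤ) :=
  Finsupp.lmapDomain ℤ ℤ (List.cons x)

/-- The part of a chain consisting of the lists with head `x`, with this head removed. -/
noncomputable def uncons (x : W) : (List W →₀ ℤ) →ₗ[ℤ] (List W →₀ ℤ) :=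
  Finsupp.lcomapDomain (List.cons x) (List.cons_injective)

/-- The boundary of a list. -/
noncomputable def boundaryList : List W → (List W →₀ ℤ)
  | [] => 0
  | x :: l => Finsupp.single l 1 - cons x (boundaryList l)

/-- The boundary map of the augmented complex of lists. -/
noncomputable def boundary : (List W →₀ ℤ) →ₗ[ℤ] (List W →₀ ℤ) :=
  Finsupp.linearCombination ℤ boundaryList

@[simp] lemma cons_single (x : W) (l : List W) (n : ℤ) :
    cons x (Finsupp.single l n) = Finsupp.single (x :: l) n := by
  simp [cons]

@[simp] lemma boundary_single (l : List W) :
    boundary (Finsupp.single l 1) = boundaryList l := by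
  simp [boundary]

lemma boundary_cons (x : W) (c : List W →₀ ℤ) :
    boundary (cons x c) = c - cons x (boundary c) := by
  have : boundary ∘ₗ cons x = LinearMap.id - cons x ∘ₗ boundary := by
    refine Finsupp.lhom_ext' fun l => LinearMap.ext_ring ?_
    simp [boundaryList]
  exact LinearMap.congr_fun this c

lemma uncons_apply (x : W) (c : List W →₀ ℤ) (l : List W) : uncons x c l = c (x :: l) := rfl

@[simp] lemma uncons_cons (x : W) (c : List W →₀ ℤ) : uncons x (cons x c) = c := by
  ext l
  rw [uncons_apply]
  exact Finsupp.mapDomain_apply List.cons_injective c l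

lemma uncons_cons_of_ne {x y : W} (h : x ≠ y) (c : List W →₀ ℤ) : uncons x (cons y c) = 0 := by
  ext l
  rw [uncons_apply]
  exact Finsupp.mapDomain_of_notMem_range _ _ (by simpa using fun h' => h h'.symm)

@[simp] lemma uncons_single_nil (x : W) : uncons x (Finsupp.single [] (1 : ℤ)) = 0 := by
  ext l
  simp [uncons_apply]

@[simp] lemma uncons_single_cons (x : W) (l : List W) :
    uncons x (Finsupp.single (x :: l) (1 : ℤ)) = Finsupp.single l 1 := by
  rw [← cons_single, uncons_cons]

lemma uncons_single_cons_of_ne {x y : W} (h : x ≠ y) (l : List W) :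
    uncons x (Finsupp.single (y :: l) (1 : ℤ)) = 0 := by
  rw [← cons_single, uncons_cons_of_ne h]

variable (r : W → W → Prop)

/-- The decreasing lists of length `d` with entries in `Q`. -/
def lists (d : ℕ) (Q : Set W) : Set (List W) :=
  {l | l.length = d ∧ l.Pairwise r ∧ ∀ x ∈ l, x ∈ Q}

/-- The group of chains of `Q` with `d` vertices. -/
noncomputable def chains (d : ℕ) (Q : Set W) : Submodule ℤ (List W →₀ ℤ) :=
  Finsupp.supported ℤ ℤ (lists r d Q)

/-- Every cycle of `Q` with `d` vertices is a boundary: the reduced homology of `Q` vanishes in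
degree `d - 1`. -/
def Exact (d : ℕ) (Q : Set W) : Prop :=
  ∀ c ∈ chains r d Q, boundary c = 0 → ∃ e ∈ chains r (d + 1) Q, boundary e = c

variable {r}

lemma chains_mono {d : ℕ} {Q Q' : Set W} (h : Q ⊆ Q') : chains r d Q ≤ chains r d Q' :=
  Finsupp.supported_mono fun _ hl => ⟨hl.1, hl.2.1, fun x hx => h (hl.2.2 x hx)⟩

lemma single_mem_chains {d : ℕ} {Q : Set W} {l : List W} (hl : l ∈ lists r d Q) :
    Finsupp.single l (1 : ℤ) ∈ chains r d Q :=
  Finsupp.single_mem_supported ℤ _ hl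

lemma chains_induction {d : ℕ} {Q : Set W} {M : Type*} [AddCommGroup M] {f : (List W →₀ ℤ) →ₗ[ℤ] M}
    {N : Submodule ℤ M} (h : ∀ l ∈ lists r d Q, f (Finsupp.single l 1) ∈ N)
    {c : List W →₀ ℤ} (hc : c ∈ chains r d Q) : f c ∈ N := by
  have : chains r d Q ≤ N.comap f := by
    rw [chains, Finsupp.supported_eq_span_single, Submodule.span_le]
    rintro _ ⟨l, hl, rfl⟩
    exact h l hl
  exact this hc

lemma cons_mem_chains {d : ℕ} {Q Q' : Set W} {x : W} (hx : x ∈ Q') (hQ : Q ⊆ Q')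
    (hr : ∀ y ∈ Q, r x y) {c : List W →₀ ℤ} (hc : c ∈ chains r d Q) :
    cons x c ∈ chains r (d + 1) Q' := by
  refine chains_induction (fun l hl => ?_) hc
  rw [cons_single]
  refine single_mem_chains ⟨by simp [hl.1], ?_, ?_⟩
  · exact List.pairwise_cons.2 ⟨fun y hy => hr y (hl.2.2 y hy), hl.2.1⟩
  · rintro y hy
    rcases List.mem_cons.1 hy with rfl | hy
    exacts [hx, hQ (hl.2.2 y hy)]

lemma uncons_mem_chains {d : ℕ} {Q : Set W} (x : W) {c : List W →₀ ℤ}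
    (hc : c ∈ chains r (d + 1) Q) : uncons x c ∈ chains r d {y ∈ Q | r x y} := by
  refine chains_induction (fun l hl => ?_) hc
  obtain ⟨hlen, hp, hQ⟩ := hl
  rcases l with _ | ⟨y, l⟩
  · simp
  · by_cases h : x = y
    · subst h
      rw [uncons_single_cons]
      rw [List.pairwise_cons] at hp
      exact single_mem_chains ⟨by simpa using hlen, hp.2,
        fun z hz => ⟨hQ z (List.mem_cons_of_mem _ hz), hp.1 z hz⟩⟩
    · rw [uncons_single_cons_of_ne h]
      exact zero_mem _

lemma uncons_eq_zero {d : ℕ} {Q : Set W} {x : W} (hx : x ∉ Q) {c : List W →₀ ℤ}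
    (hc : c ∈ chains r d Q) : uncons x c = 0 := by
  refine (Submodule.mem_bot ℤ).1 (chains_induction (fun l hl => ?_) hc)
  rw [Submodule.mem_bot]
  rcases l with _ | ⟨y, l⟩
  · simp
  · refine uncons_single_cons_of_ne ?_ l
    rintro rfl
    exact hx (hl.2.2 x (by simp))

/-- A maximal x can occur only as the head of a list, so deleting another head never exposes it; the
sign comes from moving the boundary past x. -/
lemma uncons_boundary {d : ℕ} {Q : Set W} {x : W} (hx : ∀ y ∈ Q, ¬ r y x) {c : List W →₀ ℤ}
    (hc : c ∈ chains r d Q) : uncons x (boundary c) = - boundary (uncons x c) := by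
  suffices h : (uncons x ∘ₗ boundary + boundary ∘ₗ uncons x) c ∈ (⊥ : Submodule ℤ _) from
    eq_neg_of_add_eq_zero_left h
  refine chains_induction (fun l hl => ?_) hc
  rw [Submodule.mem_bot]
  obtain ⟨-, hp, hQ⟩ := hl
  rcases l with _ | ⟨y, l⟩
  · simp [boundaryList]
  · have h0 : uncons x (Finsupp.single l (1 : ℤ)) = 0 := by
      rcases l with _ | ⟨z, l⟩
      · simp
      · refine uncons_single_cons_of_ne ?_ l
        rintro rfl
        exact hx y (hQ y (by simp)) ((List.pairwise_cons.1 hp).1 _ (by simp))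
    by_cases h : x = y
    · subst h
      simp [boundaryList, h0]
    · simp [boundaryList, h0, uncons_cons_of_ne h, uncons_single_cons_of_ne h]

/-- Removing the lists that start with one of the maximal elements `x ∈ B` leaves a chain of
`Q \ B`. -/
lemma sub_sum_cons_uncons_mem {d : ℕ} {Q : Set W} {B : Finset W}
    (hB : ∀ x ∈ B, ∀ y ∈ Q, ¬ r y x) {c : List W →₀ ℤ} (hc : c ∈ chains r d Q) :
    c - ∑ x ∈ B, cons x (uncons x c) ∈ chains r d (Q \ B) := by
  classical
  have h := chains_induction (f := LinearMap.id - ∑ x ∈ B, cons x ∘ₗ uncons x)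
    (N := chains r d (Q \ B)) (fun l hl => ?_) hc
  · simpa using h
  obtain ⟨hlen, hp, hQ⟩ := hl
  simp only [LinearMap.sub_apply, LinearMap.id_apply, LinearMap.sum_apply, LinearMap.comp_apply]
  rcases l with _ | ⟨y, l⟩
  · simpa using single_mem_chains ⟨hlen, hp, by simp⟩
  · by_cases hy : y ∈ B
    · rw [Finset.sum_eq_single_of_mem y hy
        fun x _ hx => by rw [uncons_single_cons_of_ne hx, map_zero]]
      simp
    · rw [Finset.sum_eq_zero fun x hx => by
        rw [uncons_single_cons_of_ne (ne_of_mem_of_not_mem hx hy), map_zero], sub_zero]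
      refine single_mem_chains ⟨hlen, hp, fun z hz => ⟨hQ z hz, fun hzB => ?_⟩⟩
      rcases List.mem_cons.1 hz with rfl | hz
      · exact hy hzB
      · exact hB z hzB y (hQ y (by simp)) ((List.pairwise_cons.1 hp).1 z hz)

/-! ### Cones and the removal of maximal elements -/

/-- A poset with a greatest element is acyclic. -/
lemma exact_of_top {Q : Set W} {t : W} (ht : t ∈ Q) (htop : ∀ y ∈ Q, y ≠ t → r t y)
    (hmax : ∀ y ∈ Q, ¬ r y t) (d : ℕ) : Exact r d Q := by
  intro c hc h0
  have hmem := sub_sum_cons_uncons_mem (B := {t}) (by simpa using hmax) hc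
  rw [Finset.sum_singleton, Finset.coe_singleton] at hmem
  have hu := uncons_boundary hmax hc
  rw [h0, map_zero, eq_comm, neg_eq_zero] at hu
  -- Cone construction: strip from c the lists headed by t, then put t in front of what is left.
  refine ⟨_, cons_mem_chains ht Set.sdiff_subset (fun y hy => htop y hy.1 hy.2) hmem, ?_⟩
  rw [boundary_cons, map_sub, h0, boundary_cons, hu]
  simp

/-- If removing finitely many maximal elements `x ∈ B` of `Q` leaves a poset with a greatest
element, then the reduced homology of `Q` is the direct sum of the shifted reduced homologies
of the `Q_{< x}`. -/
lemma exact_succ_iff {Q : Set W} {B : Finset W} (hBQ : (B : Set W) ⊆ Q)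
    (hB : ∀ x ∈ B, ∀ y ∈ Q, ¬ r y x) {t : W} (ht : t ∈ Q \ B)
    (htop : ∀ y ∈ Q \ B, y ≠ t → r t y) (hmax : ∀ y ∈ Q, ¬ r y t) (d : ℕ) :
    Exact r (d + 1) Q ↔ ∀ x ∈ B, Exact r d {y ∈ Q | r x y} := by
  have hD := exact_of_top ht htop fun y hy => hmax y hy.1
  have hsub : ∀ x ∈ B, {y ∈ Q | r x y} ⊆ Q \ B := fun x hx y hy =>
    ⟨hy.1, fun hyB => hB y hyB x (hBQ hx) hy.2⟩
  constructor
  · intro hQ x hx z hz hz0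
    obtain ⟨w, hw, rfl⟩ := hD d z (chains_mono (hsub x hx) hz) hz0
    -- The cycle z = ∂w is filled twice, by the cone from x and by w; the difference is a cycle of
    -- Q. The part headed by x of a chain bounding it then fills z, up to sign.
    have hc : cons x (boundary w) - w ∈ chains r (d + 1) Q :=
      sub_mem (cons_mem_chains (hBQ hx) (fun y hy => hy.1) (fun y hy => hy.2) hz)
        (chains_mono Set.sdiff_subset hw)
    obtain ⟨e, he, hec⟩ := hQ _ hc (by rw [map_sub, boundary_cons, hz0]; simp)
    refine ⟨- uncons x e, neg_mem (uncons_mem_chains x he), ?_⟩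
    rw [map_neg, ← uncons_boundary (hB x hx) he, hec, map_sub, uncons_cons,
      uncons_eq_zero (fun h => h.2 hx) hw, sub_zero]
  · intro h c hc hc0
    have hx : ∀ x : W, ∃ e : List W →₀ ℤ,
        x ∈ B → e ∈ chains r (d + 1) {y ∈ Q | r x y} ∧ boundary e = uncons x c := by
      intro x
      by_cases hxB : x ∈ B
      · have hu := uncons_boundary (hB x hxB) hc
        rw [hc0, map_zero, eq_comm, neg_eq_zero] at hu
        obtain ⟨e, he⟩ := h x hxB _ (uncons_mem_chains x hc) hu
        exact ⟨e, fun _ => he⟩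
      · exact ⟨0, fun h => absurd h hxB⟩
    choose e he using hx
    -- Adding ∂(∑ x·eₓ) to c trades every list headed by some x ∈ B for eₓ, so the resulting cycle
    -- lies in the cone `Q \ B`.
    have hmem : c - ∑ x ∈ B, cons x (uncons x c) + ∑ x ∈ B, e x ∈ chains r (d + 1) (Q \ B) :=
      add_mem (sub_sum_cons_uncons_mem hB hc)
        (sum_mem fun x hx => chains_mono (hsub x hx) (he x hx).1)
    have hbd : boundary (∑ x ∈ B, cons x (e x)) =
        ∑ x ∈ B, e x - ∑ x ∈ B, cons x (uncons x c) := by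
      rw [map_sum, ← Finset.sum_sub_distrib]
      exact Finset.sum_congr rfl fun x hx => by rw [boundary_cons, (he x hx).2]
    have hbb : boundary (∑ x ∈ B, e x - ∑ x ∈ B, cons x (uncons x c)) = 0 := by
      rw [← Finset.sum_sub_distrib, map_sum]
      refine Finset.sum_eq_zero fun x hx => ?_
      have hu := uncons_boundary (hB x hx) hc
      rw [hc0, map_zero, eq_comm, neg_eq_zero] at hu
      rw [map_sub, boundary_cons, (he x hx).2, hu, map_zero, sub_zero, sub_self]
    obtain ⟨f, hf, hfc⟩ := hD (d + 1) _ hmem (by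
      rw [sub_add_eq_add_sub, add_sub_assoc, map_add, hc0, hbb, add_zero])
    refine ⟨f - ∑ x ∈ B, cons x (e x), sub_mem (chains_mono Set.sdiff_subset hf)
      (sum_mem fun x hx => cons_mem_chains (hBQ hx) (fun y hy => hy.1) (fun y hy => hy.2)
        (he x hx).1), ?_⟩
    rw [map_sub, hfc, hbd]
    abel

lemma chains_succ_empty (d : ℕ) : chains r (d + 1) (∅ : Set W) = ⊥ := by
  have h : lists r (d + 1) (∅ : Set W) = ∅ := by
    refine Set.eq_empty_of_forall_notMem fun l hl => ?_
    rcases l with _ | ⟨x, l⟩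
    · exact Nat.succ_ne_zero d hl.1.symm
    · exact hl.2.2 x (by simp)
  rw [chains, h, Finsupp.supported_empty]

lemma exact_succ_empty (d : ℕ) : Exact r (d + 1) (∅ : Set W) := by
  intro c hc _
  refine ⟨0, zero_mem _, ?_⟩
  rw [chains_succ_empty, Submodule.mem_bot] at hc
  rw [map_zero, hc]

lemma not_exact_zero_empty : ¬ Exact r 0 (∅ : Set W) := by
  intro h
  obtain ⟨e, he, hb⟩ := h (Finsupp.single [] 1)
    (single_mem_chains ⟨rfl, List.Pairwise.nil, by simp⟩) (by simp [boundaryList])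
  rw [chains_succ_empty, Submodule.mem_bot] at he
  rw [he, map_zero] at hb
  exact one_ne_zero (Finsupp.single_eq_zero.1 hb.symm)

lemma boundaryList_ofFn {n : ℕ} (f : Fin (n + 1) → W) :
    boundaryList (List.ofFn f) = ∑ k : Fin (n + 1),
      Finsupp.single (List.ofFn fun j => f (k.succAbove j)) ((-1 : ℤ) ^ (k : ℕ)) := by
  induction n with
  | zero => simp [boundaryList]
  | succ n ih =>
    rw [List.ofFn_succ, boundaryList, ih, Fin.sum_univ_succ (n := n + 1), map_sum, sub_eq_add_neg,
      ← Finset.sum_neg_distrib]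
    congr 1
    refine Finset.sum_congr rfl fun k _ => ?_
    rw [cons_single, List.ofFn_succ, ← Finsupp.single_neg]
    simp [pow_succ]

end ListChain

/-! ### Comparison with the homology of the complex of chains -/

namespace OrderedSimplicialComplex

open ListChain

variable {V W : Type*} [PartialOrder V]

/-- The decreasing list of the vertices of a simplex. -/
def Simplex.toList {K : OrderedSimplicialComplex V} {n : ℕ} (g : V → W) (x : K.Simplex n) :
    List W :=
  List.ofFn fun k => g (x.1 k.rev)

lemma Simplex.toList_injective {K : OrderedSimplicialComplex V} {n : ℕ} {g : V → W}
    (hg : Function.Injective g) : Function.Injective (Simplex.toList (K := K) (n := n) g) := by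
  intro x y h
  refine Subtype.ext (RelEmbedding.ext fun k => hg ?_)
  simpa using congrFun (List.ofFn_injective h) k.rev

lemma range_toList {r : W → W → Prop} {g : V → W} (hr : ∀ x y, r (g y) (g x) ↔ x < y) (n : ℕ) :
    Set.range (Simplex.toList (K := complexOfChains V) (n := n) g) =
      lists r (n + 1) (Set.range g) := by
  ext l
  constructor
  · rintro ⟨x, rfl⟩
    refine ⟨by simp [Simplex.toList], ?_, ?_⟩
    · rw [Simplex.toList, List.pairwise_ofFn]
      intro i j hij
      rw [hr]
      exact x.1.strictMono (Fin.rev_lt_rev.2 hij)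
    · intro y hy
      obtain ⟨k, rfl⟩ := (List.mem_ofFn' _ _).1 hy
      exact ⟨_, rfl⟩
  · rintro ⟨hlen, hp, hQ⟩
    obtain ⟨f, rfl⟩ : ∃ f : Fin (n + 1) → W, List.ofFn f = l := by
      refine ⟨fun k => l.get (k.cast hlen.symm), ?_⟩
      rw [← List.ofFn_congr hlen, List.ofFn_get]
    rw [List.pairwise_ofFn] at hp
    have hf : ∀ k, ∃ v, g v = f k := fun k => hQ (f k) ((List.mem_ofFn' _ _).2 ⟨k, rfl⟩)
    choose v hv using hf
    have hmono : StrictMono fun k : Fin (n + 1) => v k.rev := fun i j hij => by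
      rw [← hr, hv, hv]
      exact hp (Fin.rev_lt_rev.2 hij)
    refine ⟨⟨OrderEmbedding.ofStrictMono _ hmono, by simp, ?_⟩, ?_⟩
    · intro p hp q hq _
      simp only [Finset.coe_map, Finset.coe_univ, Set.image_univ, Set.mem_range] at hp hq
      obtain ⟨i, rfl⟩ := hp
      obtain ⟨j, rfl⟩ := hq
      exact (le_total i j).imp (fun h => hmono.monotone h) (fun h => hmono.monotone h)
    · simp [Simplex.toList, hv]

/-- The identification of simplicial chains with chains of lists. -/
noncomputable def toListChain (K : OrderedSimplicialComplex V) (n : ℕ) (g : V → W) :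
    K.Chains n →ₗ[ℤ] (List W →₀ ℤ) :=
  Finsupp.lmapDomain ℤ ℤ (Simplex.toList g)

lemma toListChain_injective (K : OrderedSimplicialComplex V) (n : ℕ) {g : V → W}
    (hg : Function.Injective g) : Function.Injective (K.toListChain n g) :=
  Finsupp.mapDomain_injective (Simplex.toList_injective hg)

lemma range_toListChain {r : W → W → Prop} {g : V → W} (hr : ∀ x y, r (g y) (g x) ↔ x < y)
    (n : ℕ) : LinearMap.range ((complexOfChains V).toListChain n g) =
      chains r (n + 1) (Set.range g) := by
  rw [chains, ← range_toList hr, ← Set.image_univ, ← Finsupp.lmapDomain_supported,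
    Finsupp.supported_univ, Submodule.map_top, toListChain]

/-- The lists run downwards while simplices are enumerated upwards; reversing the deletion index
costs the global sign, which affects neither cycles nor boundaries. -/
lemma boundary_toListChain (K : OrderedSimplicialComplex V) (n : ℕ) (g : V → W)
    (c : K.Chains (n + 1)) : ListChain.boundary (K.toListChain (n + 1) g c) =
      (-1 : ℤ) ^ (n + 1) • K.toListChain n g (K.boundary n c) := by
  have : ListChain.boundary ∘ₗ K.toListChain (n + 1) g =
      (-1 : ℤ) ^ (n + 1) • (K.toListChain n g ∘ₗ K.boundary n) := by
    refine Finsupp.lhom_ext' fun x => LinearMap.ext_ring ?_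
    simp only [toListChain, boundary, LinearMap.comp_apply, LinearMap.smul_apply,
      Finsupp.lsingle_apply, Finsupp.lmapDomain_apply, Finsupp.mapDomain_single,
      Finsupp.linearCombination_single, one_smul, map_sum, boundary_single]
    rw [Finset.smul_sum, Simplex.toList, boundaryList_ofFn]
    refine Fintype.sum_equiv Fin.revPerm _ _ fun k => ?_
    rw [Finsupp.smul_single]
    congr 1
    · simp only [Simplex.toList, Simplex.face, Fin.rev_succAbove]
      rfl
    · rw [Fin.revPerm_apply, smul_eq_mul, ← pow_add, Fin.val_rev]
      have hk : n + 1 + (n + 1 + 1 - (k + 1)) = k + 2 * (n + 1 - k) := by omega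
      rw [hk, pow_add, pow_mul]
      simp
  exact LinearMap.congr_fun this c

lemma nontrivial_homology_iff (K : OrderedSimplicialComplex V) (n : ℕ) :
    Nontrivial (K.Homology n) ↔ ¬ K.cycles n ≤ LinearMap.range (K.boundary n) := by
  rw [Submodule.Quotient.nontrivial_iff, Ne, Submodule.submoduleOf, Submodule.comap_subtype_eq_top]

lemma nontrivial_homology_zero {K : OrderedSimplicialComplex V} (x : K.Simplex 0) :
    Nontrivial (K.Homology 0) := by
  rw [nontrivial_homology_iff]
  intro h
  obtain ⟨e, he⟩ := h (x := Finsupp.single x 1) trivial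
  -- The augmentation kills boundaries but sends a vertex to 1.
  have : Finsupp.linearCombination ℤ (fun _ : K.Simplex 0 => (1 : ℤ)) ∘ₗ K.boundary 0 = 0 := by
    refine Finsupp.lhom_ext' fun x => LinearMap.ext_ring ?_
    simp [boundary]
  have := LinearMap.congr_fun this e
  rw [LinearMap.comp_apply, he] at this
  simp at this

lemma nontrivial_homology_succ_iff {r : W → W → Prop} {g : V → W} (hg : Function.Injective g)
    (hr : ∀ x y, r (g y) (g x) ↔ x < y) (n : ℕ) :
    Nontrivial ((complexOfChains V).Homology (n + 1)) ↔ ¬ Exact r (n + 2) (Set.range g) := by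
  rw [nontrivial_homology_iff, not_iff_not, Exact, ← range_toListChain hr, ← range_toListChain hr]
  have hs : ∀ m : ℕ, (-1 : ℤ) ^ m * (-1) ^ m = 1 := fun m => by rw [← mul_pow]; simp
  constructor
  · rintro h _ ⟨c, rfl⟩ hc
    have hc0 : (complexOfChains V).boundary n c = 0 := by
      refine toListChain_injective _ n hg ?_
      rw [boundary_toListChain] at hc
      simpa using hc
    obtain ⟨e, rfl⟩ := h hc0
    refine ⟨_, ⟨(-1 : ℤ) ^ (n + 2) • e, rfl⟩, ?_⟩
    rw [boundary_toListChain, map_smul, map_smul, smul_smul, hs, one_smul]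
  · intro h c hc
    obtain ⟨_, ⟨e, rfl⟩, he⟩ := h _ ⟨c, rfl⟩ (by
      rw [boundary_toListChain, LinearMap.mem_ker.1 hc, map_zero, smul_zero])
    refine ⟨(-1 : ℤ) ^ (n + 2) • e, toListChain_injective _ _ hg ?_⟩
    rw [← he, boundary_toListChain, map_smul, map_smul]

end OrderedSimplicialComplex

/-! ### The posets of proper divisibility -/

namespace ProperDivisorPoset

open ListChain

/-- The nonzero proper divisors of `p`: the open interval below `p`. -/
def below (p : ℕ × ℕ) : Set (ℕ × ℕ) :=
  {x | ProperlyDivides x p ∧ x ≠ (0, 0)}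

/-- The reduced homology of the open interval below `p` does not vanish in degree `d - 1`. -/
def NonExact (d : ℕ) (p : ℕ × ℕ) : Prop :=
  ¬ Exact (fun x y => ProperlyDivides y x) d (below p)

/-- The maximal elements of the open interval below `p`, except for the largest one. -/
def corners (p : ℕ × ℕ) : Finset (ℕ × ℕ) :=
  (Finset.range (p.2 - 1)).image (fun j => (p.1 - 1, j)) ∪
    (Finset.range (p.1 - 1)).image (fun i => (i, p.2 - 1))

lemma mem_corners {p x : ℕ × ℕ} : x ∈ corners p ↔
    (x.1 = p.1 - 1 ∧ x.2 < p.2 - 1) ∨ (x.1 < p.1 - 1 ∧ x.2 = p.2 - 1) := by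
  obtain ⟨i, j⟩ := x
  simp only [corners, Finset.mem_union, Finset.mem_image, Finset.mem_range, Prod.mk.injEq]
  constructor
  · rintro (⟨k, hk, rfl, rfl⟩ | ⟨k, hk, rfl, rfl⟩)
    · exact Or.inl ⟨rfl, hk⟩
    · exact Or.inr ⟨hk, rfl⟩
  · rintro (⟨h, h'⟩ | ⟨h, h'⟩)
    · exact Or.inl ⟨j, h', h.symm, rfl⟩
    · exact Or.inr ⟨i, h, rfl, h'.symm⟩

/-! ### Recursion along corners -/

lemma below_of_properlyDivides {p x : ℕ × ℕ} (h : ProperlyDivides x p) :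
    {y ∈ below p | ProperlyDivides y x} = below x := by
  ext y
  simp only [below, Set.mem_ofPred_eq, ProperlyDivides] at *
  constructor
  · exact fun hy => ⟨hy.2, hy.1.2⟩
  · exact fun hy => ⟨⟨by omega, hy.2⟩, hy.1⟩

lemma nonExact_succ_iff {p : ℕ × ℕ} (h1 : 2 ≤ p.1) (h2 : 2 ≤ p.2) (d : ℕ) :
    NonExact (d + 1) p ↔ ∃ x ∈ corners p, NonExact d x := by
  have hdvd : ∀ x ∈ corners p, ProperlyDivides x p := fun x hx => by
    rw [mem_corners] at hx
    unfold ProperlyDivides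
    omega
  rw [NonExact, exact_succ_iff (B := corners p) (t := (p.1 - 1, p.2 - 1))]
  · push Not
    refine exists_congr fun x => and_congr_right fun hx => ?_
    rw [below_of_properlyDivides (hdvd x hx), NonExact]
  · intro x hx
    refine ⟨hdvd x hx, fun h => ?_⟩
    rw [Finset.mem_coe, mem_corners, h] at hx
    dsimp only at hx
    omega
  · intro x hx y hy h
    rw [mem_corners] at hx
    have := hy.1
    unfold ProperlyDivides at *
    omega
  · refine ⟨⟨?_, ?_⟩, ?_⟩
    · unfold ProperlyDivides
      dsimp only
      omega
    · rw [Ne, Prod.mk.injEq]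
      omega
    · rw [Finset.mem_coe, mem_corners]
      dsimp only
      omega
  · rintro ⟨i, j⟩ ⟨⟨hy, -⟩, hyc⟩ hne
    rw [Finset.mem_coe, mem_corners] at hyc
    rw [Ne, Prod.mk.injEq] at hne
    unfold ProperlyDivides at *
    dsimp only at *
    omega
  · rintro y ⟨hy, -⟩ h
    unfold ProperlyDivides at *
    dsimp only at *
    omega

lemma two_le_of_nonExact_succ {d : ℕ} {p : ℕ × ℕ} (hp : p ≠ (0, 0)) (h : NonExact (d + 1) p) :
    2 ≤ p.1 ∧ 2 ≤ p.2 := by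
  by_contra hcon
  refine h ?_
  obtain ⟨a, b⟩ := p
  rw [Ne, Prod.mk.injEq] at hp
  dsimp only at hcon
  by_cases hsmall : a ≤ 1 ∧ b ≤ 1
  · have : below (a, b) = ∅ := by
      refine Set.eq_empty_of_forall_notMem ?_
      rintro ⟨i, j⟩ ⟨h1, h2⟩
      rw [Ne, Prod.mk.injEq] at h2
      unfold ProperlyDivides at h1
      dsimp only at h1
      omega
    rw [this]
    exact exact_succ_empty d
  -- Truncated subtraction keeps a zero coordinate at zero, and a coordinate 1 forces zero below it;
  -- hence this is the greatest element.
  · have ht : (a - 1, b - 1) ∈ below (a, b) := by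
      refine ⟨?_, ?_⟩
      · unfold ProperlyDivides
        dsimp only
        omega
      · rw [Ne, Prod.mk.injEq]
        omega
    refine exact_of_top ht ?_ ?_ _
    · rintro ⟨i, j⟩ ⟨h1, h2⟩ hne
      rw [Ne, Prod.mk.injEq] at h2 hne
      unfold ProperlyDivides at *
      dsimp only at *
      omega
    · rintro ⟨i, j⟩ ⟨h1, h2⟩ h3
      rw [Ne, Prod.mk.injEq] at h2
      unfold ProperlyDivides at *
      dsimp only at *
      omega

lemma exists_corner_of_nonExact_succ {d : ℕ} {p : ℕ × ℕ} (hp : p ≠ (0, 0))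
    (h : NonExact (d + 1) p) : 2 ≤ p.1 ∧ 2 ≤ p.2 ∧ ∃ x ∈ corners p, x ≠ (0, 0) ∧ NonExact d x := by
  obtain ⟨h1, h2⟩ := two_le_of_nonExact_succ hp h
  obtain ⟨x, hx, hxd⟩ := (nonExact_succ_iff h1 h2 d).1 h
  refine ⟨h1, h2, x, hx, ?_, hxd⟩
  rintro rfl
  rw [mem_corners] at hx
  dsimp only at hx
  omega

/-! ### Which degrees survive -/

lemma le_of_nonExact {d : ℕ} {p : ℕ × ℕ} (hp : p ≠ (0, 0)) (h : NonExact d p) : d ≤ p.1 := by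
  induction d generalizing p with
  | zero => exact Nat.zero_le _
  | succ d ih =>
    obtain ⟨h1, h2, x, hx, hx0, hxd⟩ := exists_corner_of_nonExact_succ hp h
    have := ih hx0 hxd
    rw [mem_corners] at hx
    omega

/-- The corner path p → (p.1 - 1, 2) → (0, 1) ends at an empty interval; the two bounds are what its
steps require. -/
lemma nonExact_two {p : ℕ × ℕ} (h1 : 3 ≤ p.1) (h2 : 4 ≤ p.2) : NonExact 2 p := by
  refine (nonExact_succ_iff (by omega) (by omega) 1).2 ⟨(p.1 - 1, 2), ?_, ?_⟩
  · rw [mem_corners]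
    dsimp only
    omega
  refine (nonExact_succ_iff (by dsimp only; omega) le_rfl 0).2 ⟨(0, 1), ?_, ?_⟩
  · rw [mem_corners]
    dsimp only
    omega
  have : below (0, 1) = ∅ := by
    refine Set.eq_empty_of_forall_notMem ?_
    rintro ⟨i, j⟩ ⟨h1, h2⟩
    rw [Ne, Prod.mk.injEq] at h2
    unfold ProperlyDivides at h1
    dsimp only at h1
    omega
  rw [NonExact, this]
  exact not_exact_zero_empty

lemma three_le_of_nonExact_two {p : ℕ × ℕ} (hp : p ≠ (0, 0)) (h : NonExact 2 p) :
    3 ≤ p.1 ∧ 3 ≤ p.2 := by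
  obtain ⟨h1, h2, x, hx, hx0, hxd⟩ := exists_corner_of_nonExact_succ hp h
  have := two_le_of_nonExact_succ hx0 hxd
  rw [mem_corners] at hx
  omega

lemma nonExact_of_succ {d : ℕ} {p : ℕ × ℕ} (hp : p ≠ (0, 0)) (h : NonExact (d + 3) p) :
    NonExact (d + 2) p := by
  induction d generalizing p with
  | zero =>
    obtain ⟨h1, h2, x, hx, hx0, hxd⟩ := exists_corner_of_nonExact_succ hp h
    have := three_le_of_nonExact_two hx0 hxd
    rw [mem_corners] at hx
    -- The corner x has both coordinates at least 3, and p exceeds it by at least 1 in one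
    -- coordinate and at least 2 in the other.
    exact nonExact_two (by omega) (by omega)
  | succ d ih =>
    obtain ⟨h1, h2, x, hx, hx0, hxd⟩ := exists_corner_of_nonExact_succ hp h
    exact (nonExact_succ_iff h1 h2 _).2 ⟨x, hx, ih hx0 hxd⟩

lemma nontrivial_homology_succ_iff {a b : ℕ} (n : ℕ) :
    Nontrivial ((orderComplex (ProperDivisorPoset a b)).Homology (n + 1)) ↔
      NonExact (n + 2) (a, b) := by
  have hbot : (⊥ : ProperDivisorPoset a b).1 = (0, 0) := rfl
  have htop : (⊤ : ProperDivisorPoset a b).1 = (a, b) := rfl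
  have hrange : Set.range (fun x : {p : ProperDivisorPoset a b // p ≠ ⊥ ∧ p ≠ ⊤} => x.1.1) =
      below (a, b) := by
    ext x
    constructor
    · rintro ⟨⟨⟨x, hx⟩, h1, h2⟩, rfl⟩
      exact ⟨hx.resolve_left fun h => h2 (Subtype.ext h), fun h => h1 (Subtype.ext h)⟩
    · rintro ⟨h1, h2⟩
      refine ⟨⟨⟨x, Or.inr h1⟩, fun h => h2 ?_, fun h => h2 ?_⟩, rfl⟩
      · exact congrArg Subtype.val h
      · have hx : x = (a, b) := congrArg Subtype.val h
        subst hx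
        unfold ProperlyDivides at h1
        rw [Prod.mk.injEq]
        omega
  rw [NonExact, ← hrange]
  refine OrderedSimplicialComplex.nontrivial_homology_succ_iff ?_ ?_ n
  · exact fun x y h => Subtype.ext (Subtype.ext h)
  · intro x y
    rw [lt_iff_le_and_ne]
    constructor
    · intro h
      refine ⟨Or.inr h, ?_⟩
      rintro rfl
      refine x.2.1 (Subtype.ext ?_)
      rw [hbot]
      unfold ProperlyDivides at h
      exact Prod.ext (by omega) (by omega)
    · rintro ⟨h, hne⟩
      exact h.resolve_left fun h => hne (Subtype.ext (Subtype.ext h))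

lemma nontrivial_homology_zero {a b : ℕ} (h1 : 2 ≤ a) (h2 : 2 ≤ b) :
    Nontrivial ((orderComplex (ProperDivisorPoset a b)).Homology 0) := by
  let v : {p : ProperDivisorPoset a b // p ≠ ⊥ ∧ p ≠ ⊤} :=
    ⟨⟨(0, 1), Or.inr (by unfold ProperlyDivides; dsimp only; omega)⟩,
      fun h => by
        have h' : ((0, 1) : ℕ × ℕ) = (0, 0) := congrArg Subtype.val h
        simp at h',
      fun h => by
        have h' : ((0, 1) : ℕ × ℕ) = (a, b) := congrArg Subtype.val h
        rw [Prod.mk.injEq] at h'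
        omega⟩
  refine OrderedSimplicialComplex.nontrivial_homology_zero
    ⟨OrderEmbedding.ofStrictMono (fun _ => v) (fun i j h => absurd h (by omega)), by simp, ?_⟩
  intro p hp q hq _
  simp only [Finset.coe_map, Finset.coe_univ, Set.image_univ, Set.mem_range] at hp hq
  obtain ⟨i, rfl⟩ := hp
  obtain ⟨j, rfl⟩ := hq
  exact Or.inl le_rfl

end ProperDivisorPoset

theorem proposition1p4 (a b : ℕ) (ha : 2 ≤ a) (hab : a ≤ b) :
    ∃ t : ℕ, ∀ i : ℕ,
      Nontrivial ((orderComplex (ProperDivisorPoset a b)).Homology i) ↔ i ≤ t := by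
  classical
  set H : ℕ → Prop := fun i => Nontrivial ((orderComplex (ProperDivisorPoset a b)).Homology i)
  have hp : (a, b) ≠ (0, 0) := by
    rw [Ne, Prod.mk.injEq]
    omega
  have h0 : H 0 := ProperDivisorPoset.nontrivial_homology_zero ha (ha.trans hab)
  have hstep : ∀ i, H (i + 1) → H i := by
    rintro (_ | i) h
    · exact h0
    · exact (ProperDivisorPoset.nontrivial_homology_succ_iff i).2
        (ProperDivisorPoset.nonExact_of_succ hp
          ((ProperDivisorPoset.nontrivial_homology_succ_iff (i + 1)).1 h))
  have hle : ∀ i, H i → i ≤ a := by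
    rintro (_ | i) h
    · exact Nat.zero_le _
    · have := ProperDivisorPoset.le_of_nonExact hp
        ((ProperDivisorPoset.nontrivial_homology_succ_iff i).1 h)
      dsimp only at this
      omega
  refine ⟨Nat.findGreatest H a, fun i => ⟨fun h => Nat.le_findGreatest (hle i h) h, fun h => ?_⟩⟩
  have hmax : H (Nat.findGreatest H a) := Nat.findGreatest_spec (Nat.zero_le a) h0
  exact Nat.decreasingInduction' (P := H) (fun k _ _ => hstep k) h hmax
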